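/- Let $\mathcal S_\infty$ be the group of permutations of $\{1,2,3,\dots\}$ that fix all but finitely many numbers, let $\ell(w)$ be the number of inversions of $w\in\mathcal S_\infty$, and let $(a\,b)$ denote a transposition. For $k\ge 0$, the $k$-Bruhat order $\le_k$ on $\mathcal S_\infty$ is the reflexive and transitive closure of the relation that holds between $u$ and $u(a\,b)$ when $a\le k<b$ and $\ell(u(a\,b))=\ell(u)+1$. The universal $k$-Bruhat order is defined by: $\eta\preceq\zeta$ if and only if there are $u\in\mathcal S_\infty$ and $k$ with $u\le_k\eta u\le_k\zeta u$. Its rank function is $\ell_{\mathbf u}(\zeta)=\ell(\zeta u)-\ell(u)$ for any $u,k$ with $u\le_k\zeta u$ (such $u,k$ exist, and the value does not depend on them). For integers $0<\alpha<\beta$ let $\hat{\mathbf u}_{\alpha\beta}$ be the linear operator on the rational vector space $\mathbb Q\mathcal S_\infty$ with basis $\mathcal S_\infty$ given by $$\hat{\mathbf u}_{\alpha\beta}\,\zeta=\begin{cases}(\alpha\,\beta)\zeta & \text{if } (\alpha\,\beta)\zeta \text{ covers } \zeta \text{ in } \preceq \text{, i.e. } \zeta\preceq(\alpha\,\beta)\zeta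 \text{ and } \ell_{\mathbf u}((\alpha\,\beta)\zeta)=\ell_{\mathbf u}(\zeta)+1,\\ 0&\text{otherwise,}\end{cases}\qquad \zeta\in\mathcal S_\infty .$$ Consider formal words in letters $\mathbf u_{\alpha\beta}$ ($0<\alpha<\beta$ integers), together with an absorbing element $0$, and let $\equiv$ be the monoid congruence generated by the relations 1. $\mathbf u_{\beta\gamma}\mathbf u_{\gamma\delta}\mathbf u_{\alpha\gamma}\equiv\mathbf u_{\beta\delta}\mathbf u_{\alpha\beta}\mathbf u_{\beta\gamma}$ if $\alpha<\beta<\gamma<\delta$; 2. $\mathbf u_{\alpha\gamma}\mathbf u_{\gamma\delta}\mathbf u_{\beta\gamma}\equiv\mathbf u_{\beta\gamma}\mathbf u_{\alpha\beta}\mathbf u_{\beta\delta}$ if $\alpha<\beta<\gamma<\delta$; 3. $\mathbf u_{\alpha\beta}\mathbf u_{\gamma\delta}\equiv\mathbf u_{\gamma\delta}\mathbf u_{\alpha\beta}$ if $\beta<\gamma$ or $\alpha<\gamma<\delta<\beta$ (with $\alpha<\beta$, $\gamma<\delta$); 4. $\mathbf u_{\alpha\gamma}\mathbf u_{\beta\delta}\equiv\mathbf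 u_{\beta\delta}\mathbf u_{\alpha\gamma}\equiv 0$ if $\alpha\le\beta<\gamma\le\delta$; 5. $\mathbf u_{\beta\gamma}\mathbf u_{\alpha\beta}\mathbf u_{\beta\gamma}\equiv\mathbf u_{\alpha\beta}\mathbf u_{\beta\gamma}\mathbf u_{\alpha\beta}\equiv 0$ if $\alpha<\beta<\gamma$. **Theorem.** Let $n\ge 0$ and let $0<\alpha_i<\beta_i$ be integers for $1\le i\le n$. If the composition $\hat{\mathbf u}_{\alpha_n\beta_n}\cdots\hat{\mathbf u}_{\alpha_1\beta_1}$ sends the identity permutation $1\in\mathbb Q\mathcal S_\infty$ to $0$, then $\mathbf u_{\alpha_n\beta_n}\cdots\mathbf u_{\alpha_1\beta_1}\equiv 0$. -/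

import Mathlib

namespace UniversalBruhat

/-- The infinite symmetric group: the permutations of `{1, 2, 3, …}` that fix all but finitely
many numbers. -/
def SInf : Subgroup (Equiv.Perm ℕ+) where
  carrier := {σ | {i | σ i ≠ i}.Finite}
  one_mem' := by simp
  mul_mem' := by
    intro σ τ hσ hτ
    refine (Set.Finite.union hσ hτ).subset ?_
    intro i hi
    by_contra h
    simp only [Set.mem_union, Set.mem_ofPred_eq, not_or, not_not] at h
    exact hi (by simp [h.1, h.2])
  inv_mem' := by
    intro σ hσ
    refine Set.Finite.subset hσ ?_
    intro i hi h
    exact hi (Equiv.Perm.inv_eq_iff_eq.2 h.symm)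

/-- The transposition `(a b)` as an element of the infinite symmetric group. -/
def transp (a b : ℕ+) : SInf :=
  ⟨Equiv.swap a b, by
    refine (Set.toFinite {a, b}).subset ?_
    intro i hi
    by_contra h
    simp only [Set.mem_insert_iff, Set.mem_singleton_iff, not_or] at h
    exact hi (Equiv.swap_apply_of_ne_of_ne h.1 h.2)⟩

/-- The length of a permutation: its number of inversions. -/
noncomputable def length (w : SInf) : ℕ :=
  {p : ℕ+ × ℕ+ | p.1 < p.2 ∧ w.1 p.2 < w.1 p.1}.ncard

/-- Covers of the `k`-Bruhat order: `w = u (a b)` with `a ≤ k < b` and `ℓ(w) = ℓ(u) + 1`. -/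
def KCover (k : ℕ) (u w : SInf) : Prop :=
  ∃ a b : ℕ+, (a : ℕ) ≤ k ∧ k < (b : ℕ) ∧ w = u * transp a b ∧ length w = length u + 1

/-- The `k`-Bruhat order. -/
def KLe (k : ℕ) : SInf → SInf → Prop :=
  Relation.ReflTransGen (KCover k)

/-- The universal `k`-Bruhat order: `η ⪯ ζ` if and only if `u ≤ₖ η u ≤ₖ ζ u` for some `u`, `k`. -/
def ULe (η ζ : SInf) : Prop :=
  ∃ (u : SInf) (k : ℕ), KLe k u (η * u) ∧ KLe k (η * u) (ζ * u)

/-- The rank function of `⪯`: the common value of `ℓ(ζ u) - ℓ(u)` over all `u`, `k` with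
`u ≤ₖ ζ u` (such `u`, `k` exist for every `ζ`, and the difference does not depend on them). -/
noncomputable def uLength (ζ : SInf) : ℕ :=
  sInf {n | ∃ (u : SInf) (k : ℕ), KLe k u (ζ * u) ∧ length (ζ * u) = length u + n}

/-- The indices of the generators: pairs of integers `0 < α < β`. -/
structure Idx where
  fst : ℕ+
  snd : ℕ+
  lt : fst < snd

open Classical in
/-- The operator `û_{αβ}` on the rational vector space with basis the infinite symmetric group:
it sends a permutation `ζ` to `(α β) ζ` if `(α β) ζ` covers `ζ` in the universal order, that is,
lies above `ζ` and has rank one more, and to `0` otherwise. -/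
noncomputable def uHat (g : Idx) : Module.End ℚ (SInf →₀ ℚ) :=
  Finsupp.linearCombination ℚ fun ζ : SInf =>
    if ULe ζ (transp g.fst g.snd * ζ) ∧ uLength (transp g.fst g.snd * ζ) = uLength ζ + 1 then
      Finsupp.single (transp g.fst g.snd * ζ) (1 : ℚ)
    else 0

/-- The free monoid with zero on letters `u_{αβ}`, `0 < α < β`. -/
abbrev FreeWords : Type := WithZero (FreeMonoid Idx)

/-- The letter `u_{αβ}`. -/
def letter {α β : ℕ+} (h : α < β) : FreeWords :=
  ((FreeMonoid.of (⟨α, β, h⟩ : Idx) : FreeMonoid Idx) : WithZero (FreeMonoid Idx))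

/-- The defining relations. -/
inductive Rel : FreeWords → FreeWords → Prop
  | braid_left {α β γ δ : ℕ+} (h₁ : α < β) (h₂ : β < γ) (h₃ : γ < δ) :
      Rel (letter h₂ * letter h₃ * letter (h₁.trans h₂))
        (letter (h₂.trans h₃) * letter h₁ * letter h₂)
  | braid_right {α β γ δ : ℕ+} (h₁ : α < β) (h₂ : β < γ) (h₃ : γ < δ) :
      Rel (letter (h₁.trans h₂) * letter h₃ * letter h₂)
        (letter h₂ * letter h₁ * letter (h₂.trans h₃))
  | comm {α β γ δ : ℕ+} (h₁ : α < β) (h₂ : γ < δ) (h : β < γ ∨ (α < γ ∧ δ < β)) :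
      Rel (letter h₁ * letter h₂) (letter h₂ * letter h₁)
  | cross_left {α β γ δ : ℕ+} (h₁ : α ≤ β) (h₂ : β < γ) (h₃ : γ ≤ δ) :
      Rel (letter (h₁.trans_lt h₂) * letter (h₂.trans_le h₃)) 0
  | cross_right {α β γ δ : ℕ+} (h₁ : α ≤ β) (h₂ : β < γ) (h₃ : γ ≤ δ) :
      Rel (letter (h₂.trans_le h₃) * letter (h₁.trans_lt h₂)) 0
  | aba_left {α β γ : ℕ+} (h₁ : α < β) (h₂ : β < γ) :
      Rel (letter h₂ * letter h₁ * letter h₂) 0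
  | aba_right {α β γ : ℕ+} (h₁ : α < β) (h₂ : β < γ) :
      Rel (letter h₁ * letter h₂ * letter h₁) 0

/-- Equivalence modulo the relations: the monoid congruence that they generate. The quotient of
`FreeWords` by it is the monoid with zero presented by the letters and the relations. -/
def modRel : Con FreeWords := conGen Rel

end UniversalBruhat

/-! Left multiplication of ζ by (α β) exchanges two values of ζ, hence two positions of π = ζ⁻¹, so
all conditions are expressed through π. `Legal` says when a letter may act, `Coatom` describes the
state just after, and `Reach` attaches to a state the monoid elements written by legal letters.

Two facts follow by strong induction on word length. Exchange (`exch`): every coatom of the state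
reached by x is the last letter of some expression for x. Any two coatoms are last letters of the
same elements: apart ones commute, and the others are joined by a braid relation or through further
coatoms. Vanishing (`vanish`): a letter illegal on the state of x annihilates x. Exchange supplies a
convenient last letter of x; the illegal letter then meets a zero relation, or moves onto a shorter
product that it annihilates by induction.

Finally, legal letters are covers of the universal order (`Reach.covers`): legal chains lift to
k-Bruhat chains over a suitable u, and k-Bruhat chains come from legal letters, so the number of
letters is the rank. Hence the composition of operators can be zero only if some letter is illegal
on its state, and vanishing applies. -/

namespace UniversalBruhat

open Equiv OrderDual

/-! ### Legal letters and coatoms of finitely supported permutations -/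

section Model

variable {L : Type*}

/-- The permutation has finite support. -/
def FinSupp (π : Perm L) : Prop := {x | π x ≠ x}.Finite

theorem FinSupp.one : FinSupp (1 : Perm L) := by simp [FinSupp]

/-- The permutation of the order dual. -/
def dualPerm (π : Perm L) : Perm Lᵒᵈ := OrderDual.toDual.permCongr π

@[simp] theorem dualPerm_toDual (π : Perm L) (x : L) : dualPerm π (toDual x) = toDual (π x) := rfl

theorem FinSupp.dual {π : Perm L} (h : FinSupp π) : FinSupp (dualPerm π) := h

variable [LinearOrder L]

/-- `Legal π a b`: the operator `û_{ab}` does not kill the permutation inverse to `π`. -/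
def Legal (π : Perm L) (a b : L) : Prop :=
  a < b ∧ π a ≤ a ∧ b ≤ π b ∧ ∀ c, a < c → c < b → π a < π c ∧ π c < π b

/-- `Coatom π a b`: the inverse of `π` can be reached by the operator `û_{ab}`. -/
def Coatom (π : Perm L) (a b : L) : Prop :=
  a < b ∧ π b ≤ a ∧ b ≤ π a ∧ ∀ c, a < c → c < b → π b < π c ∧ π c < π a

/-- The intervals `[a, b]` and `[p, q]` are disjoint or strictly nested. -/
def Apart (a b p q : L) : Prop :=
  q < a ∨ b < p ∨ (a < p ∧ q < b) ∨ (p < a ∧ b < q)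

theorem Apart.symm {a b p q : L} (h : Apart a b p q) : Apart p q a b := by
  unfold Apart at *; tauto

theorem coatom_mul_swap {π : Perm L} {a b : L} : Coatom (π * swap a b) a b ↔ Legal π a b := by
  unfold Coatom Legal
  simp only [Perm.mul_apply, swap_apply_left, swap_apply_right]
  refine and_congr_right fun _ => and_congr_right fun _ => and_congr_right fun _ => ?_
  refine forall_congr' fun c => forall_congr' fun h1 => forall_congr' fun h2 => ?_
  rw [swap_apply_of_ne_of_ne h1.ne' h2.ne]

theorem legal_mul_swap {π : Perm L} {a b : L} : Legal (π * swap a b) a b ↔ Coatom π a b := by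
  rw [← coatom_mul_swap, mul_assoc, swap_mul_self, mul_one]

theorem Apart.swap_apply_endpoints {a b p q : L} (h : Apart a b p q) (hab : a < b) (hpq : p < q) :
    swap p q a = a ∧ swap p q b = b := by
  constructor <;> apply swap_apply_of_ne_of_ne <;> rintro rfl <;>
    rcases h with h | h | ⟨h1, h2⟩ | ⟨h1, h2⟩ <;> order

theorem Apart.swap_apply_between {a b p q c : L} (h : Apart a b p q) (hpq : p < q)
    (h1 : a < c) (h2 : c < b) : a < swap p q c ∧ swap p q c < b := by
  rcases eq_or_ne c p with rfl | hp
  · rw [swap_apply_left]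
    rcases h with h | h | h | h <;> constructor <;> order
  rcases eq_or_ne c q with rfl | hq
  · rw [swap_apply_right]
    rcases h with h | h | h | h <;> constructor <;> order
  rw [swap_apply_of_ne_of_ne hp hq]
  exact ⟨h1, h2⟩

theorem Coatom.mul_swap {π : Perm L} {a b p q : L} (h : Coatom π a b) (hpq : p < q)
    (ha : Apart a b p q) : Coatom (π * swap p q) a b := by
  obtain ⟨e1, e2⟩ := ha.swap_apply_endpoints h.1 hpq
  refine ⟨h.1, ?_, ?_, fun c h1 h2 => ?_⟩
  · simpa [e2] using h.2.1
  · simpa [e1] using h.2.2.1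
  · obtain ⟨h3, h4⟩ := ha.swap_apply_between hpq h1 h2
    simpa [e1, e2] using h.2.2.2 _ h3 h4

theorem Legal.mul_swap {π : Perm L} {a b p q : L} (h : Legal π a b) (hpq : p < q)
    (ha : Apart a b p q) : Legal (π * swap p q) a b := by
  obtain ⟨e1, e2⟩ := ha.swap_apply_endpoints h.1 hpq
  refine ⟨h.1, ?_, ?_, fun c h1 h2 => ?_⟩
  · simpa [e1] using h.2.1
  · simpa [e2] using h.2.2.1
  · obtain ⟨h3, h4⟩ := ha.swap_apply_between hpq h1 h2
    simpa [e1, e2] using h.2.2.2 _ h3 h4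

theorem legal_mul_swap_iff {π : Perm L} {a b p q : L} (hpq : p < q) (ha : Apart a b p q) :
    Legal (π * swap p q) a b ↔ Legal π a b := by
  refine ⟨fun h => ?_, fun h => h.mul_swap hpq ha⟩
  simpa [mul_assoc] using h.mul_swap hpq ha

theorem swap_commute {a b p q : L} (hab : a < b) (hpq : p < q) (h : Apart a b p q) :
    swap a b * swap p q = swap p q * swap a b := by
  obtain ⟨e1, e2⟩ := h.swap_apply_endpoints hab hpq
  have := mul_swap_eq_swap_mul (swap p q) a b
  rw [e1, e2] at this
  exact this.symm

theorem FinSupp.mul_swap {π : Perm L} (h : FinSupp π) (a b : L) : FinSupp (π * swap a b) := by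
  refine (Set.Finite.union h (Set.toFinite {a, b})).subset ?_
  intro i hi
  by_contra hc
  simp only [Set.mem_union, Set.mem_ofPred_eq, Set.mem_insert_iff, Set.mem_singleton_iff, not_or,
    not_not] at hc
  apply hi
  simp [swap_apply_of_ne_of_ne hc.2.1 hc.2.2, hc.1]

/-- A finitely supported permutation that maps a set to itself maps its complement to itself. -/
theorem FinSupp.mem_of_apply_mem {π : Perm L} (h : FinSupp π) {S : Set L}
    (hS : ∀ x ∈ S, π x ∈ S) {x : L} (hx : π x ∈ S) : x ∈ S := by
  by_cases hfix : π x = x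
  · rwa [hfix] at hx
  have hT : (S ∩ {x | π x ≠ x}).Finite := h.inter_of_right S
  have hmaps : Set.MapsTo π (S ∩ {x | π x ≠ x}) (S ∩ {x | π x ≠ x}) := fun y hy =>
    ⟨hS y hy.1, fun e => hy.2 (π.injective e)⟩
  -- An injective self-map of a finite set is onto.
  have hsurj := (hT.injOn_iff_bijOn_of_mapsTo hmaps).1 π.injective.injOn |>.surjOn
  obtain ⟨t, ht, he⟩ := hsurj ⟨hx, fun e => hfix (π.injective e)⟩
  rw [← π.injective he]
  exact ht.1

/-- Otherwise the open ray above `a` is invariant, and by finite support it would contain `a`, whose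
image it contains. -/
theorem FinSupp.exists_first {π : Perm L} (h : FinSupp π) {a : L} (ha : a < π a) :
    ∃ q, a < q ∧ π q ≤ a ∧ ∀ z, a < z → z < q → a < π z := by
  have hne : {q | a < q ∧ π q ≤ a}.Nonempty := by
    by_contra hc
    rw [Set.not_nonempty_iff_eq_empty] at hc
    have : a ∈ Set.Ioi a := h.mem_of_apply_mem (S := Set.Ioi a) (fun x hx => by
      by_contra hx'
      exact Set.eq_empty_iff_forall_notMem.1 hc x ⟨hx, not_lt.1 hx'⟩) ha
    exact lt_irrefl _ this
  have hfin : {q | a < q ∧ π q ≤ a}.Finite := h.subset fun q hq => (hq.2.trans_lt hq.1).ne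
  obtain ⟨q, hq, hmin⟩ := Set.exists_min_image _ id hfin hne
  refine ⟨q, hq.1, hq.2, fun z hz hzq => ?_⟩
  by_contra hc
  exact absurd (hmin z ⟨hz, not_lt.1 hc⟩) (not_le.2 hzq)

/-- Otherwise `[a, q)` is invariant and contains the preimage of `a`, although all its values exceed
`a`. -/
theorem FinSupp.exists_large {π : Perm L} (h : FinSupp π) {a q : L} (haq : a < q)
    (hz : ∀ z, a ≤ z → z < q → a < π z) : ∃ p, a ≤ p ∧ p < q ∧ q ≤ π p := by
  by_contra! hc
  have hS : ∀ x ∈ Set.Ico a q, π x ∈ Set.Ico a q := fun x hx =>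
    ⟨(hz x hx.1 hx.2).le, hc x hx.1 hx.2⟩
  have : π.symm a ∈ Set.Ico a q := h.mem_of_apply_mem hS (by simpa using haq)
  simpa using hz _ this.1 this.2

theorem FinSupp.exists_last {π : Perm L} (h : FinSupp π) {P : L → Prop} {q : L}
    (hP : ∃ p, P p ∧ p < q ∧ q ≤ π p) :
    ∃ p, P p ∧ p < q ∧ q ≤ π p ∧ ∀ z, P z → p < z → z < q → π z < q := by
  have hfin : {p | P p ∧ p < q ∧ q ≤ π p}.Finite :=
    h.subset fun p hp => (hp.2.1.trans_le hp.2.2).ne'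
  obtain ⟨p, hp, hmax⟩ := Set.exists_max_image _ id hfin hP
  refine ⟨p, hp.1, hp.2.1, hp.2.2, fun z hz hpz hzq => ?_⟩
  by_contra hc
  exact absurd (hmax z ⟨hz, hzq, not_lt.1 hc⟩) (not_le.2 hpz)

/-- Take for `q` the first position beyond `a` whose value drops to `a` or lower, and for `p` the
last position in `[a, q)` whose value is at least `q`. -/
theorem exists_coatom_of_lt {π : Perm L} (h : FinSupp π) {a : L} (ha : a < π a) :
    ∃ p q, Coatom π p q ∧ a ≤ p ∧ π q ≤ a ∧ (∀ z, a < z → z < q → a < π z) ∧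
      ∀ z, p < z → z < q → π z < q := by
  obtain ⟨q, haq, hq, hfirst⟩ := h.exists_first ha
  have hz : ∀ z, a ≤ z → z < q → a < π z := fun z h1 h2 => by
    rcases h1.eq_or_lt with rfl | h1
    exacts [ha, hfirst z h1 h2]
  obtain ⟨p, hap, hpq, hqp, hlast⟩ := h.exists_last (h.exists_large haq hz)
  have hlast' : ∀ z, p < z → z < q → π z < q := fun z h1 h2 => hlast z (hap.trans h1.le) h1 h2
  exact ⟨p, q, ⟨hpq, hq.trans hap, hqp, fun z h1 h2 =>
    ⟨hq.trans_lt (hfirst z (hap.trans_lt h1) h2), (hlast' z h1 h2).trans_le hqp⟩⟩, hap, hq,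
    hfirst, hlast'⟩

theorem dualPerm_mul_swap (π : Perm L) (a b : L) :
    dualPerm (π * swap a b) = dualPerm π * swap (toDual b) (toDual a) := by
  ext x
  obtain ⟨x, rfl⟩ := toDual.surjective x
  rw [dualPerm_toDual, Perm.mul_apply, Perm.mul_apply]
  rcases eq_or_ne x a with rfl | ha
  · rw [swap_apply_left, swap_apply_right, dualPerm_toDual]
  rcases eq_or_ne x b with rfl | hb
  · rw [swap_apply_left, swap_apply_right, dualPerm_toDual]
  rw [swap_apply_of_ne_of_ne ha hb, swap_apply_of_ne_of_ne (by simpa) (by simpa), dualPerm_toDual]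

/-- Order reversal preserves the whole setting and exchanges lower and upper endpoints, which halves
the case analyses. -/
theorem legal_dual {π : Perm L} {a b : L} :
    Legal (dualPerm π) (toDual b) (toDual a) ↔ Legal π a b := by
  constructor
  · rintro ⟨h1, h2, h3, h4⟩
    exact ⟨h1, h3, h2, fun c hc1 hc2 => (h4 (toDual c) hc2 hc1).symm⟩
  · rintro ⟨h1, h2, h3, h4⟩
    exact ⟨h1, h3, h2, fun c hc1 hc2 => (h4 (ofDual c) hc2 hc1).symm⟩

theorem coatom_dual {π : Perm L} {a b : L} :
    Coatom (dualPerm π) (toDual b) (toDual a) ↔ Coatom π a b := by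
  rw [← legal_mul_swap, ← legal_mul_swap, ← dualPerm_mul_swap, legal_dual]

theorem exists_coatom_of_gt {π : Perm L} (h : FinSupp π) {a : L} (ha : π a < a) :
    ∃ p q, Coatom π p q ∧ q ≤ a ∧ a ≤ π p ∧ (∀ z, p < z → z < a → π z < a) ∧
      ∀ z, p < z → z < q → p < π z := by
  obtain ⟨q, p, hc, h1, h2, h3, h4⟩ := exists_coatom_of_lt h.dual (a := toDual a) ha
  exact ⟨ofDual p, ofDual q, coatom_dual.1 hc, h1, h2, fun z hz1 hz2 => h3 (toDual z) hz2 hz1,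
    fun z hz1 hz2 => h4 (toDual z) hz2 hz1⟩

end Model

end UniversalBruhat

namespace UniversalBruhat

open Equiv OrderDual

/-! ### The exchange property -/

section Exchange

variable {M : Type*} [MonoidWithZero M] {L : Type*} [LinearOrder L]

/-- The defining relations, for a family `u a b` of elements of a monoid with zero. -/
structure Rels (u : L → L → M) : Prop where
  braid_left {a b c d : L} (hab : a < b) (hbc : b < c) (hcd : c < d) :
    u b c * u c d * u a c = u b d * u a b * u b c
  braid_right {a b c d : L} (hab : a < b) (hbc : b < c) (hcd : c < d) :
    u a c * u c d * u b c = u b c * u a b * u b d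
  comm_disj {a b c d : L} (hab : a < b) (hbc : b < c) (hcd : c < d) :
    u a b * u c d = u c d * u a b
  comm_nest {a b c d : L} (hac : a < c) (hcd : c < d) (hdb : d < b) :
    u a b * u c d = u c d * u a b
  cross_left {a b c d : L} (hab : a ≤ b) (hbc : b < c) (hcd : c ≤ d) : u a c * u b d = 0
  cross_right {a b c d : L} (hab : a ≤ b) (hbc : b < c) (hcd : c ≤ d) : u b d * u a c = 0
  aba_left {a b c : L} (hab : a < b) (hbc : b < c) : u b c * u a b * u b c = 0
  aba_right {a b c : L} (hab : a < b) (hbc : b < c) : u a b * u b c * u a b = 0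

/-- The family indexed by the order dual. -/
def dualFamily (u : L → L → M) : Lᵒᵈ → Lᵒᵈ → M := fun a b => u (ofDual b) (ofDual a)

theorem Rels.dual {u : L → L → M} (hu : Rels u) : Rels (dualFamily u) where
  braid_left h1 h2 h3 := (hu.braid_right h3 h2 h1).symm
  braid_right h1 h2 h3 := (hu.braid_left h3 h2 h1).symm
  comm_disj h1 h2 h3 := (hu.comm_disj h3 h2 h1).symm
  comm_nest h1 h2 h3 := hu.comm_nest h3 h2 h1
  cross_left h1 h2 h3 := hu.cross_right h3 h2 h1
  cross_right h1 h2 h3 := hu.cross_left h3 h2 h1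
  aba_left h1 h2 := hu.aba_right h2 h1
  aba_right h1 h2 := hu.aba_left h2 h1

theorem Rels.comm {u : L → L → M} (hu : Rels u) {a b p q : L} (hab : a < b) (hpq : p < q)
    (h : Apart a b p q) : u a b * u p q = u p q * u a b := by
  rcases h with h | h | h | h
  · exact (hu.comm_disj hpq h hab).symm
  · exact hu.comm_disj hab h hpq
  · exact hu.comm_nest h.1 hpq h.2
  · exact (hu.comm_nest h.1 hab h.2).symm

/-- `Reach u n x π`: the element `x` is a product of `n` letters that sends the identity to the
inverse of `π`. -/
inductive Reach (u : L → L → M) : ℕ → M → Perm L → Prop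
  | one : Reach u 0 1 1
  | step {n : ℕ} {x : M} {π : Perm L} {a b : L} (h : Reach u n x π) (hl : Legal π a b) :
      Reach u (n + 1) (u a b * x) (π * swap a b)

theorem Reach.finSupp {u : L → L → M} {n : ℕ} {x : M} {π : Perm L} (h : Reach u n x π) :
    FinSupp π := by
  induction h with
  | one => exact .one
  | step _ _ ih => exact ih.mul_swap _ _

theorem Reach.of_coatom {u : L → L → M} {n : ℕ} {x : M} {π : Perm L} {a b : L}
    (hc : Coatom π a b) (h : Reach u n x (π * swap a b)) : Reach u (n + 1) (u a b * x) π := by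
  simpa [mul_assoc] using h.step (legal_mul_swap.2 hc)

theorem Reach.dual {u : L → L → M} {n : ℕ} {x : M} {π : Perm L} (h : Reach u n x π) :
    Reach (dualFamily u) n x (dualPerm π) := by
  induction h with
  | one => exact .one
  | step _ hl ih =>
    rw [dualPerm_mul_swap]
    exact ih.step (legal_dual.2 hl)

theorem reach_dual {u : L → L → M} {n : ℕ} {x : M} {π : Perm L} :
    Reach (dualFamily u) n x (dualPerm π) ↔ Reach u n x π :=
  ⟨fun h => h.dual, fun h => h.dual⟩

/-- The element `x` is a product of `u a b` and an element reaching `π * swap a b`. -/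
def Last (u : L → L → M) (n : ℕ) (π : Perm L) (a b : L) (x : M) : Prop :=
  ∃ y, Reach u n y (π * swap a b) ∧ x = u a b * y

theorem last_dual {u : L → L → M} {n : ℕ} {π : Perm L} {a b : L} {x : M} :
    Last (dualFamily u) n (dualPerm π) (toDual b) (toDual a) x ↔ Last u n π a b x := by
  unfold Last
  simp_rw [← dualPerm_mul_swap, reach_dual]
  rfl

/-- Every coatom of the state of a product of `n` letters is the last letter of some expression
for this product. -/
def Exch (u : L → L → M) (n : ℕ) : Prop :=
  ∀ ⦃x : M⦄ ⦃π : Perm L⦄, Reach u n x π → ∀ ⦃a b : L⦄, Coatom π a b →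
    ∃ m, n = m + 1 ∧ Last u m π a b x

theorem Exch.dual {u : L → L → M} {n : ℕ} (h : Exch u n) : Exch (dualFamily u) n := by
  intro x π hx a b hc
  obtain ⟨m, hm, hl⟩ := h (π := dualPerm π) (Reach.dual hx) (a := ofDual b) (b := ofDual a)
    (coatom_dual.2 hc)
  exact ⟨m, hm, (last_dual (u := u) (π := dualPerm π) (a := ofDual b) (b := ofDual a)).2 hl⟩

/-- Two coatoms are linked if they are last letters of the same products. -/
def Linked (u : L → L → M) (n : ℕ) (π : Perm L) (a b p q : L) : Prop :=
  ∀ x, Last u n π a b x ↔ Last u n π p q x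

theorem Linked.symm {u : L → L → M} {n : ℕ} {π : Perm L} {a b p q : L}
    (h : Linked u n π a b p q) : Linked u n π p q a b := fun x => (h x).symm

theorem Linked.trans {u : L → L → M} {n : ℕ} {π : Perm L} {a b c d p q : L}
    (h : Linked u n π a b c d) (h' : Linked u n π c d p q) : Linked u n π a b p q :=
  fun x => (h x).trans (h' x)

theorem linked_dual {u : L → L → M} {n : ℕ} {π : Perm L} {a b p q : L} :
    Linked (dualFamily u) n (dualPerm π) (toDual b) (toDual a) (toDual q) (toDual p) ↔
      Linked u n π a b p q := by
  unfold Linked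
  simp_rw [last_dual]

/-- Each coatom survives the removal of the other, so exchange on the shorter word brings it to the
end, and the two letters commute. -/
theorem linked_of_apart {u : L → L → M} (hu : Rels u) {n : ℕ} (hE : Exch u n) {π : Perm L}
    {a b p q : L} (hab : Coatom π a b) (hpq : Coatom π p q) (h : Apart a b p q) :
    Linked u n π a b p q := by
  have key : ∀ {a b p q : L}, Coatom π a b → Coatom π p q → Apart a b p q → ∀ x,
      Last u n π a b x → Last u n π p q x := by
    rintro a b p q hab hpq h x ⟨y, hy, rfl⟩
    obtain ⟨m, rfl, z, hz, rfl⟩ := hE hy (hpq.mul_swap hab.1 h.symm)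
    refine ⟨u a b * z, ?_, ?_⟩
    · refine Reach.of_coatom (hab.mul_swap hpq.1 h) ?_
      rwa [mul_assoc, ← swap_commute hab.1 hpq.1 h, ← mul_assoc]
    · rw [← mul_assoc, ← mul_assoc, hu.comm hab.1 hpq.1 h]
  exact fun x => ⟨key hab hpq h x, key hpq hab h.symm x⟩

theorem braid_perm {d p c e : L} (hdp : d < p) (hpc : p < c) (hce : c < e) :
    swap p c * swap d p * swap p e = swap d c * swap c e * swap p c := by
  have h1 : swap p c * swap d p = swap d c * swap p c := by
    rw [mul_swap_eq_swap_mul, swap_apply_left,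
      swap_apply_of_ne_of_ne hdp.ne (hdp.trans hpc).ne]
  have h2 : swap p c * swap p e = swap c e * swap p c := by
    rw [mul_swap_eq_swap_mul, swap_apply_left,
      swap_apply_of_ne_of_ne (hpc.trans hce).ne' hce.ne']
  rw [h1, mul_assoc, h2, mul_assoc]

/-- The conditions on `e` make both sides of `braid_right` removable from `π` letter by letter.
Given the last letter of either side, exchange on shorter words produces its other two. -/
theorem linked_braid {u : L → L → M} (hu : Rels u) {n : ℕ} (hE : ∀ k ≤ n, Exch u k) {π : Perm L}
    {d p c e : L} (hdc : Coatom π d c) (hpc : Coatom π p c) (hdp : d < p) (hce : c < e)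
    (hep : π e ≤ p) (hed : e ≤ π d) (hz1 : ∀ z, p < z → z < c → p < π z)
    (hz2 : ∀ z, c < z → z < e → p < π z ∧ π z < e) :
    Linked u n π d c p c := by
  have hpe := hpc.1.trans hce
  have hde := hdp.trans hpe
  have hdc' := hdc.1
  have hpc' := hpc.1
  obtain ⟨hd1, hd2⟩ := hdc.2.2.2 p hdp hpc'
  -- the states along the two sides of the braid relation
  have c1 : Coatom (π * swap p c) d p := by
    refine ⟨hdp, ?_, ?_, fun z h1 h2 => ?_⟩
    · simpa using hdc.2.1
    · rw [Perm.mul_apply, swap_apply_of_ne_of_ne hdp.ne hdc'.ne]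
      exact hpc'.le.trans hdc.2.2.1
    · rw [Perm.mul_apply, Perm.mul_apply, Perm.mul_apply, swap_apply_left,
        swap_apply_of_ne_of_ne hdp.ne hdc'.ne,
        swap_apply_of_ne_of_ne h2.ne (h2.trans hpc').ne]
      exact hdc.2.2.2 z h1 (h2.trans hpc')
  have c2 : Coatom (π * swap p c * swap d p) p e := by
    have tp : (π * swap p c * swap d p) p = π d := by
      simp [swap_apply_of_ne_of_ne hdp.ne hdc'.ne]
    have te : ∀ z, c < z → (π * swap p c * swap d p) z = π z := fun z hz => by
      simp only [Perm.mul_apply]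
      rw [swap_apply_of_ne_of_ne (hdc'.trans hz).ne' (hpc'.trans hz).ne',
        swap_apply_of_ne_of_ne (hpc'.trans hz).ne' hz.ne']
    refine ⟨hpe, by rwa [te e hce], by rwa [tp], fun z h1 h2 => ?_⟩
    rw [te e hce, tp]
    rcases lt_trichotomy z c with h | rfl | h
    · have : (π * swap p c * swap d p) z = π z := by
        simp only [Perm.mul_apply]
        rw [swap_apply_of_ne_of_ne (hdp.trans h1).ne' h1.ne', swap_apply_of_ne_of_ne h1.ne' h.ne]
      rw [this]
      exact ⟨hep.trans_lt (hz1 z h1 h), (hdc.2.2.2 z (hdp.trans h1) h).2⟩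
    · have : (π * swap p z * swap d p) z = π p := by
        simp only [Perm.mul_apply]
        rw [swap_apply_of_ne_of_ne hdc'.ne' h1.ne', swap_apply_right]
      rw [this]
      exact ⟨hep.trans_lt (h1.trans_le hpc.2.2.1), hd2⟩
    · rw [te z h]
      exact ⟨hep.trans_lt (hz2 z h h2).1, (hz2 z h h2).2.trans_le hed⟩
  have c3 : Coatom (π * swap d c) c e := by
    have te : ∀ z, c < z → (π * swap d c) z = π z := fun z hz => by
      rw [Perm.mul_apply, swap_apply_of_ne_of_ne (hdc'.trans hz).ne' hz.ne']
    have tc : (π * swap d c) c = π d := by simp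
    refine ⟨hce, by rw [te e hce]; exact hep.trans hpc'.le, by rwa [tc], fun z h1 h2 => ?_⟩
    rw [te e hce, te z h1, tc]
    exact ⟨hep.trans_lt (hz2 z h1 h2).1, (hz2 z h1 h2).2.trans_le hed⟩
  have c4 : Coatom (π * swap d c * swap c e) p c := by
    have tp : ∀ z, p ≤ z → z < c → (π * swap d c * swap c e) z = π z := fun z h1 h2 => by
      simp only [Perm.mul_apply]
      rw [swap_apply_of_ne_of_ne h2.ne (h2.trans hce).ne,
        swap_apply_of_ne_of_ne (hdp.trans_le h1).ne' h2.ne]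
    have tc : (π * swap d c * swap c e) c = π e := by
      simp only [Perm.mul_apply]
      rw [swap_apply_left, swap_apply_of_ne_of_ne hde.ne' hce.ne']
    refine ⟨hpc', by rwa [tc], by rw [tp p le_rfl hpc']; exact hpc.2.2.1, fun z h1 h2 => ?_⟩
    rw [tp p le_rfl hpc', tc, tp z h1.le h2]
    exact ⟨hep.trans_lt (hz1 z h1 h2), (hpc.2.2.2 z h1 h2).2⟩
  have hperm : π * swap p c * swap d p * swap p e = π * swap d c * swap c e * swap p c := by
    have := congrArg (π * ·) (braid_perm hdp hpc' hce)
    simpa only [mul_assoc] using this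
  have hbraid : ∀ y, u d c * (u c e * (u p c * y)) = u p c * (u d p * (u p e * y)) := fun y => by
    simp only [← mul_assoc]
    rw [hu.braid_right hdp hpc' hce]
  intro x
  constructor
  · rintro ⟨y, hy, rfl⟩
    obtain ⟨m, rfl, y2, hy2, rfl⟩ := hE _ le_rfl hy c3
    obtain ⟨m, rfl, y3, hy3, rfl⟩ := hE _ (Nat.le_succ _) hy2 c4
    rw [← hperm] at hy3
    exact ⟨_, (hy3.of_coatom c2).of_coatom c1, hbraid y3⟩
  · rintro ⟨y, hy, rfl⟩
    obtain ⟨m, rfl, y2, hy2, rfl⟩ := hE _ le_rfl hy c1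
    obtain ⟨m, rfl, y3, hy3, rfl⟩ := hE _ (Nat.le_succ _) hy2 c2
    rw [hperm] at hy3
    exact ⟨_, (hy3.of_coatom c4).of_coatom c3, (hbraid y3).symm⟩

/-- The fourth index of the braid is the first `e` beyond `p` where the state `τ`, left by removing
`(p c)` and `(d p)`, takes a value at most `p`; the assumption `hz1` pushes it past `c`. -/
theorem linked_upper_of_clean {u : L → L → M} (hu : Rels u) {n : ℕ} (hE : ∀ k ≤ n, Exch u k)
    {π : Perm L} (hπ : FinSupp π) {d p c : L} (hdc : Coatom π d c) (hpc : Coatom π p c)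
    (hdp : d < p) (hz1 : ∀ z, p < z → z < c → p < π z) : Linked u n π d c p c := by
  have hdc' := hdc.1
  have hpc' := hpc.1
  obtain ⟨hd1, hd2⟩ := hdc.2.2.2 p hdp hpc'
  have hτ := (hπ.mul_swap p c).mul_swap d p
  set τ := π * swap p c * swap d p with hτdef
  have tp : τ p = π d := by
    simp [hτdef, swap_apply_of_ne_of_ne hdp.ne hdc'.ne]
  have tc : τ c = π p := by
    simp only [hτdef, Perm.mul_apply]
    rw [swap_apply_of_ne_of_ne hdc'.ne' hpc'.ne', swap_apply_right]
  have tz : ∀ z, p < z → z ≠ c → τ z = π z := fun z h1 h2 => by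
    simp only [hτdef, Perm.mul_apply]
    rw [swap_apply_of_ne_of_ne (hdp.trans h1).ne' h1.ne', swap_apply_of_ne_of_ne h1.ne' h2]
  have hpp : p < τ p := by rw [tp]; exact hpc'.trans_le hdc.2.2.1
  obtain ⟨e, hpe, hep, hfirst⟩ := hτ.exists_first hpp
  have hce : c < e := by
    by_contra! h
    rcases h.eq_or_lt with rfl | h
    · rw [tc] at hep
      exact absurd (hpc'.trans_le hpc.2.2.1) (not_lt.2 hep)
    · rw [tz e hpe h.ne] at hep
      exact absurd (hz1 e hpe h) (not_lt.2 hep)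
  rw [tz e hpe hce.ne'] at hep
  have hz : ∀ z, c < z → z < e → p < π z := fun z h1 h2 => by
    rw [← tz z (hpc'.trans h1) h1.ne']
    exact hfirst z (hpc'.trans h1) h2
  -- Such an `f` gives a coatom to the right of both intervals, which links them by commutation;
  -- otherwise the braid applies.
  by_cases hf : ∃ f, c < f ∧ f < e ∧ e ≤ π f
  · obtain ⟨f, hcf, hfe, hef, hlast⟩ := hπ.exists_last (P := (c < ·)) hf
    have hco : Coatom π f e := ⟨hfe, hep.trans (hpc'.trans hcf).le, hef, fun z h1 h2 =>
      ⟨hep.trans_lt (hz z (hcf.trans h1) h2), (hlast z (hcf.trans h1) h1 h2).trans_le hef⟩⟩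
    exact (linked_of_apart hu (hE n le_rfl) hdc hco (.inr (.inl hcf))).trans
      (linked_of_apart hu (hE n le_rfl) hpc hco (.inr (.inl hcf))).symm
  · push Not at hf
    -- Some position of `[p, e)` has a `τ`-value at least `e`; those beyond `c` are excluded, and
    -- the values at the others are at most `π d`.
    have hed : e ≤ π d := by
      obtain ⟨q, hpq, hqe, heq⟩ := hτ.exists_large hpe (fun z h1 h2 => by
        rcases h1.eq_or_lt with rfl | h1
        exacts [hpp, hfirst z h1 h2])
      rcases hpq.eq_or_lt with rfl | hpq
      · rwa [tp] at heq
      rcases lt_trichotomy q c with h | rfl | h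
      · rw [tz q hpq h.ne] at heq
        exact heq.trans (hdc.2.2.2 q (hdp.trans hpq) h).2.le
      · rw [tc] at heq
        exact heq.trans hd2.le
      · rw [tz q hpq h.ne'] at heq
        exact absurd (hf q h hqe) (not_lt.2 heq)
    exact linked_braid hu hE hdc hpc hdp hce hep hed hz1 fun z h1 h2 => ⟨hz z h1 h2, hf z h1 h2⟩

theorem linked_lower_of_clean {u : L → L → M} (hu : Rels u) {n : ℕ} (hE : ∀ k ≤ n, Exch u k)
    {π : Perm L} (hπ : FinSupp π) {p e c : L} (hpe : Coatom π p e) (hpc : Coatom π p c)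
    (hec : e < c) (hz : ∀ z, p < z → z < e → π z < e) : Linked u n π p c p e :=
  linked_dual.1 (linked_upper_of_clean hu.dual (fun k hk => (hE k hk).dual) hπ.dual
    (coatom_dual.2 hpc) (coatom_dual.2 hpe) hec fun z h1 h2 => hz (ofDual z) h2 h1)

/-- In the remaining case a drop occurs before `c`. It yields a coatom ending at `e < c`: either
strictly inside both intervals, or `(p, e)`, which is strictly inside `(d, c)` and linked to `(p,
c)` by the dual clean case. -/
theorem linked_upper {u : L → L → M} (hu : Rels u) {n : ℕ} (hE : ∀ k ≤ n, Exch u k)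
    {π : Perm L} (hπ : FinSupp π) {d p c : L} (hdc : Coatom π d c) (hpc : Coatom π p c)
    (hdp : d < p) : Linked u n π d c p c := by
  by_cases hclean : ∀ z, p < z → z < c → p < π z
  · exact linked_upper_of_clean hu hE hπ hdc hpc hdp hclean
  push Not at hclean
  obtain ⟨e₀, h1, h2, h3⟩ := hclean
  obtain ⟨e, hpe, hep, hfirst⟩ := hπ.exists_first (hpc.1.trans_le hpc.2.2.1)
  have hec : e < c := by
    by_contra! hc
    exact absurd (hfirst e₀ h1 (h2.trans_le hc)) (not_lt.2 h3)
  by_cases hf : ∃ f, p < f ∧ f < e ∧ e ≤ π f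
  · obtain ⟨f, hpf, hfe, hef, hlast⟩ := hπ.exists_last (P := (p < ·)) hf
    have hco : Coatom π f e := ⟨hfe, hep.trans hpf.le, hef, fun z h1 h2 =>
      ⟨hep.trans_lt (hfirst z (hpf.trans h1) h2), (hlast z (hpf.trans h1) h1 h2).trans_le hef⟩⟩
    exact (linked_of_apart hu (hE n le_rfl) hdc hco
        (.inr (.inr (.inl ⟨hdp.trans hpf, hec⟩)))).trans
      (linked_of_apart hu (hE n le_rfl) hpc hco (.inr (.inr (.inl ⟨hpf, hec⟩)))).symm
  · push Not at hf
    have hco : Coatom π p e := ⟨hpe, hep, hec.le.trans hpc.2.2.1, fun z h1 h2 =>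
      ⟨hep.trans_lt (hfirst z h1 h2), (hf z h1 h2).trans_le (hec.le.trans hpc.2.2.1)⟩⟩
    exact (linked_of_apart hu (hE n le_rfl) hdc hco (.inr (.inr (.inl ⟨hdp, hec⟩)))).trans
      (linked_lower_of_clean hu hE hπ hco hpc hec hf).symm

theorem linked_lower {u : L → L → M} (hu : Rels u) {n : ℕ} (hE : ∀ k ≤ n, Exch u k)
    {π : Perm L} (hπ : FinSupp π) {p e c : L} (hpe : Coatom π p e) (hpc : Coatom π p c)
    (hec : e < c) : Linked u n π p c p e :=
  linked_dual.1 (linked_upper hu.dual (fun k hk => (hE k hk).dual) hπ.dual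
    (coatom_dual.2 hpc) (coatom_dual.2 hpe) hec)

/-- The overlap `(p, c)` is itself a coatom and shares an endpoint with each of the two. -/
theorem linked_cross {u : L → L → M} (hu : Rels u) {n : ℕ} (hE : ∀ k ≤ n, Exch u k)
    {π : Perm L} (hπ : FinSupp π) {d p c q : L} (hdc : Coatom π d c) (hpq : Coatom π p q)
    (hdp : d < p) (hpc : p < c) (hcq : c < q) : Linked u n π d c p q := by
  have hco : Coatom π p c := ⟨hpc, hdc.2.1.trans hdp.le, hcq.le.trans hpq.2.2.1, fun z h1 h2 =>
    ⟨(hdc.2.2.2 z (hdp.trans h1) h2).1, (hpq.2.2.2 z h1 (h2.trans hcq)).2⟩⟩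
  exact (linked_upper hu hE hπ hdc hco hdp).trans (linked_lower hu hE hπ hco hpq hcq).symm

theorem linked_of_coatom {u : L → L → M} (hu : Rels u) {n : ℕ} (hE : ∀ k ≤ n, Exch u k)
    {π : Perm L} (hπ : FinSupp π) {a b p q : L} (hab : Coatom π a b) (hpq : Coatom π p q) :
    Linked u n π a b p q := by
  wlog h : a ≤ p generalizing a b p q
  · exact (this hpq hab (not_le.1 h).le).symm
  -- The value at an upper end is below its position, the value at a lower end above it.
  have hbp : b ≠ p := by
    rintro rfl
    exact absurd (hab.2.1.trans_lt hab.1) (not_lt.2 (hpq.1.le.trans hpq.2.2.1))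
  have hE' := hE n le_rfl
  rcases h.eq_or_lt with rfl | h
  · rcases lt_trichotomy b q with h' | rfl | h'
    · exact (linked_lower hu hE hπ hab hpq h').symm
    · exact fun x => Iff.rfl
    · exact linked_lower hu hE hπ hpq hab h'
  rcases lt_trichotomy b q with h' | rfl | h'
  · rcases hbp.lt_or_gt with hbp | hbp
    · exact linked_of_apart hu hE' hab hpq (.inr (.inl hbp))
    · exact linked_cross hu hE hπ hab hpq h hbp h'
  · exact linked_upper hu hE hπ hab hpq h
  · exact linked_of_apart hu hE' hab hpq (.inr (.inr (.inl ⟨h, h'⟩)))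

theorem exch {u : L → L → M} (hu : Rels u) (n : ℕ) : Exch u n := by
  induction n using Nat.strong_induction_on with
  | _ n ih =>
    intro x π hx a b hc
    have hπ := hx.finSupp
    cases hx with
    | one => exact absurd hc.1 (not_lt.2 hc.2.1)
    | @step m y σ p q hy hl =>
      refine ⟨m, rfl, ?_⟩
      refine (linked_of_coatom hu (fun k hk => ih k (Nat.lt_succ_of_le hk)) hπ
        (coatom_mul_swap.2 hl) hc _).1 ⟨y, ?_, rfl⟩
      simpa [mul_assoc] using hy

end Exchange

end UniversalBruhat

namespace UniversalBruhat

open Equiv OrderDual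

/-! ### Illegal letters annihilate -/

section Vanishing

variable {M : Type*} [MonoidWithZero M] {L : Type*} [LinearOrder L]

/-- Letters that are not legal on the state of a product of `n` letters annihilate it. -/
def Vanish (u : L → L → M) (n : ℕ) : Prop :=
  ∀ ⦃x : M⦄ ⦃π : Perm L⦄, Reach u n x π → ∀ ⦃a b : L⦄, a < b → ¬ Legal π a b → u a b * x = 0

theorem Vanish.dual {u : L → L → M} {n : ℕ} (h : Vanish u n) : Vanish (dualFamily u) n := by
  intro x π hx a b hab hl
  exact h (π := dualPerm π) (Reach.dual hx) (a := ofDual b) (b := ofDual a) hab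
    fun hc => hl (legal_dual.2 hc)

/-- Exchange brings `u p q` next to `u a b`. Apart intervals commute, leaving `u a b` illegal on a
shorter product; in every other position a cross relation gives zero, since end-to-end contact is
excluded. -/
theorem mul_eq_zero_of_coatom {u : L → L → M} (hu : Rels u) {n : ℕ} (hV : ∀ k < n, Vanish u k)
    {x : M} {π : Perm L} (hx : Reach u n x π) {a b p q : L} (hab : a < b) (hl : ¬ Legal π a b)
    (hpq : Coatom π p q) (hqa : q ≠ a) (hpb : p ≠ b) : u a b * x = 0 := by
  obtain ⟨m, rfl, y, hy, rfl⟩ := exch hu n hx hpq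
  have hpq' := hpq.1
  have apart (h : Apart a b p q) : u a b * (u p q * y) = 0 := by
    rw [← mul_assoc, hu.comm hab hpq' h, mul_assoc,
      hV m m.lt_succ_self hy hab fun h' => hl ((legal_mul_swap_iff hpq' h).1 h'), mul_zero]
  rcases hqa.lt_or_gt with h1 | h1
  · exact apart (.inl h1)
  rcases hpb.lt_or_gt with h2 | h2
  swap
  · exact apart (.inr (.inl h2))
  rcases lt_or_ge a p with h3 | h3
  · rcases lt_or_ge q b with h4 | h4
    · exact apart (.inr (.inr (.inl ⟨h3, h4⟩)))
    · rw [← mul_assoc, hu.cross_left h3.le h2 h4, zero_mul]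
  · rcases le_or_gt q b with h4 | h4
    · rw [← mul_assoc, hu.cross_right h3 h1 h4, zero_mul]
    · rcases h3.eq_or_lt with rfl | h3
      · rw [← mul_assoc, hu.cross_left le_rfl hab h4.le, zero_mul]
      · exact apart (.inr (.inr (.inr ⟨h3, h4⟩)))

/-- Choose `c` with `π c` minimal. The drop at `c` provides a coatom `(p, q)` with `q ≤ c`. It is
usable unless `q = a`, and then minimality makes `(p, c)` a coatom. -/
theorem mul_eq_zero_of_between {u : L → L → M} (hu : Rels u) {n : ℕ} (hV : ∀ k < n, Vanish u k)
    {x : M} {π : Perm L} (hx : Reach u n x π) {a b : L} (hab : a < b) (ha : π a ≤ a)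
    (hc : ∃ c, a < c ∧ c < b ∧ π c ≤ π a) : u a b * x = 0 := by
  have hπ := hx.finSupp
  have hl : ¬ Legal π a b := fun h => by
    obtain ⟨c, h1, h2, h3⟩ := hc
    exact absurd (h.2.2.2 c h1 h2).1 (not_lt.2 h3)
  have hfin : {c | a < c ∧ c < b ∧ π c ≤ π a}.Finite :=
    hπ.subset fun c hc => ((hc.2.2.trans ha).trans_lt hc.1).ne
  obtain ⟨c, ⟨hac, hcb, hca⟩, hmin⟩ := Set.exists_min_image _ π hfin hc
  have hca' : π c < π a := lt_of_le_of_ne hca fun e => hac.ne' (π.injective e)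
  obtain ⟨p, q, hpq, hqc, hcp, hlast, hfirst⟩ :=
    exists_coatom_of_gt hπ ((hca.trans ha).trans_lt hac)
  have hp : p < b := hpq.1.trans (hqc.trans_lt hcb)
  by_cases hqa : q = a
  · subst hqa
    have hpc : Coatom π p c := by
      refine ⟨hpq.1.trans hac, hca.trans hpq.2.1, hcp, fun z h1 h2 =>
        ⟨?_, (hlast z h1 h2).trans_le hcp⟩⟩
      rcases lt_trichotomy z q with h | rfl | h
      · exact (hca.trans hpq.2.1).trans_lt (hfirst z h1 h)
      · exact hca'
      · by_contra! hz
        have := hmin z ⟨h, h2.trans hcb, hz.trans hca⟩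
        exact h2.ne (π.injective (le_antisymm hz this))
    exact mul_eq_zero_of_coatom hu hV hx hab hl hpc hac.ne' hp.ne
  · exact mul_eq_zero_of_coatom hu hV hx hab hl hpq hqa hp.ne

theorem swap_apply_lower_of_coatom {π : Perm L} {a p q : L} (hpq : Coatom π p q) (ha : a < π a)
    (hap : a ≠ p) : (π * swap p q) a = π a := by
  have haq : a ≠ q := by
    rintro rfl
    exact absurd (hpq.2.1.trans_lt hpq.1) (not_lt.2 ha.le)
  rw [Perm.mul_apply, swap_apply_of_ne_of_ne hap haq]

/-- The coatom supplied by `a < π a` is unusable only if it starts at `b`. Removing it then leaves a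
value below `b` at position `b`, hence another coatom `(c, d)` with `d ≤ b`, and the last three
letters fall under the relations. -/
theorem mul_eq_zero_of_lower {u : L → L → M} (hu : Rels u) {n : ℕ} (hV : ∀ k < n, Vanish u k)
    {x : M} {π : Perm L} (hx : Reach u n x π) {a b : L} (hab : a < b) (ha : a < π a) :
    u a b * x = 0 := by
  have hl : ¬ Legal π a b := fun h => absurd h.2.1 (not_le.2 ha)
  obtain ⟨p, q, hpq, hap, hqa, -⟩ := exists_coatom_of_lt hx.finSupp ha
  have hqa' : q ≠ a := (hap.trans_lt hpq.1).ne'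
  by_cases hpb : p = b
  swap
  · exact mul_eq_zero_of_coatom hu hV hx hab hl hpq hqa' hpb
  subst hpb
  obtain ⟨m, rfl, y, hy, rfl⟩ := exch hu n hx hpq
  have ha1 := swap_apply_lower_of_coatom hpq ha hab.ne
  have hp1 : (π * swap p q) p < p := by
    rw [Perm.mul_apply, swap_apply_left]
    exact hqa.trans_lt hab
  obtain ⟨c, d, hcd, hdp, -⟩ := exists_coatom_of_gt hy.finSupp hp1
  obtain ⟨m, rfl, z, hz, rfl⟩ := exch hu m hy hcd
  have hpq' := hpq.1
  have hcd' := hcd.1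
  -- any letter with lower index `a` annihilates products of length at most `m + 1` fixing `π a`
  have V0 : ∀ {e : L}, a ≠ c → a < e → u a e * z = 0 := fun hac hae =>
    hV m (by omega) hz hae fun h => by
      have h' := h.2.1
      rw [swap_apply_lower_of_coatom hcd (by rwa [ha1]) hac, ha1] at h'
      exact absurd h' (not_le.2 ha)
  have V1 : ∀ {e f g : L}, a ≠ c → f < g → a < e → a < f → u a e * (u f g * z) = 0 := by
    intro e f g hac hfg hae haf
    by_cases hleg : Legal (π * swap p q * swap c d) f g
    · refine hV (m + 1) (by omega) (hz.step hleg) hae fun h => ?_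
      have h' := h.2.1
      rw [Perm.mul_apply, swap_apply_of_ne_of_ne haf.ne (haf.trans hfg).ne,
        swap_apply_lower_of_coatom hcd (by rwa [ha1]) hac, ha1] at h'
      exact absurd h' (not_le.2 ha)
    · rw [hV m (by omega) hz hfg hleg, mul_zero]
  have hda : d ≠ a := by
    rintro rfl
    have := hcd.2.1.trans_lt hcd'
    rw [ha1] at this
    exact lt_asymm ha this
  rcases hdp.eq_or_lt with rfl | hdp
  -- Outside the zero case `c = a`, a braid relation places a letter with lower index `a` on a
  -- product that `V0` or `V1` annihilates.
  · rcases lt_trichotomy c a with h | rfl | h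
    · have := hu.braid_left h hab hpq'
      calc _ = u a d * u d q * u c d * z := by simp only [mul_assoc]
        _ = _ := by rw [this, mul_assoc, V0 h.ne' hab, mul_zero]
    · calc _ = u c d * u d q * u c d * z := by simp only [mul_assoc]
        _ = _ := by rw [hu.aba_right hab hpq', zero_mul]
    · have := hu.braid_right h hcd' hpq'
      calc _ = u a d * u d q * u c d * z := by simp only [mul_assoc]
        _ = _ := by rw [this, mul_assoc, mul_assoc, V1 h.ne (hcd'.trans hpq') h h, mul_zero]
  · have hcomm : u p q * u c d = u c d * u p q := hu.comm hpq' hcd' (.inl hdp)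
    have hrw : u a p * (u p q * (u c d * z)) = u a p * u c d * (u p q * z) := by
      rw [← mul_assoc (u p q), hcomm]
      simp only [mul_assoc]
    have apart (h : Apart a p c d) (hac : a ≠ c) : u a p * u c d * (u p q * z) = 0 := by
      rw [hu.comm hab hcd' h, mul_assoc, V1 hac hpq' hab hab, mul_zero]
    rw [hrw]
    rcases hda.lt_or_gt with h | h
    · exact apart (.inl h) (hcd'.trans h).ne'
    · rcases le_or_gt c a with h' | h'
      · rw [hu.cross_right h' h hdp.le, zero_mul]
      · exact apart (.inr (.inr (.inl ⟨h', hdp⟩))) h'.ne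

/-- Failures of `Legal` at the upper end are failures at the lower end for the reversed order. -/
theorem vanish {u : L → L → M} (hu : Rels u) (n : ℕ) : Vanish u n := by
  induction n using Nat.strong_induction_on with
  | _ n ih =>
    intro x π hx a b hab hl
    have ih' : ∀ k < n, Vanish (dualFamily u) k := fun k hk => (ih k hk).dual
    by_cases h1 : a < π a
    · exact mul_eq_zero_of_lower hu ih hx hab h1
    by_cases h2 : π b < b
    · exact mul_eq_zero_of_lower hu.dual ih' hx.dual (a := toDual b) (b := toDual a) hab h2
    push Not at h1 h2
    by_cases h3 : ∃ c, a < c ∧ c < b ∧ π c ≤ π a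
    · exact mul_eq_zero_of_between hu ih hx hab h1 h3
    by_cases h4 : ∃ c, a < c ∧ c < b ∧ π b ≤ π c
    · obtain ⟨c, hc1, hc2, hc3⟩ := h4
      exact mul_eq_zero_of_between hu.dual ih' hx.dual (a := toDual b) (b := toDual a) hab h2
        ⟨toDual c, hc2, hc1, hc3⟩
    push Not at h3 h4
    exact absurd ⟨hab, h1, h2, fun c hc1 hc2 => ⟨h3 c hc1 hc2, h4 c hc1 hc2⟩⟩ hl

end Vanishing

end UniversalBruhat

namespace UniversalBruhat

open Equiv

/-! ### Inversions and multiplication by a transposition -/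

section Length

/-- The set of inversions. -/
def inversions (w : Perm ℕ+) : Set (ℕ+ × ℕ+) := {p | p.1 < p.2 ∧ w p.2 < w p.1}

theorem FinSupp.exists_bound {w : Perm ℕ+} (h : FinSupp w) : ∃ N : ℕ+, ∀ i, N < i → w i = i := by
  obtain ⟨N, hN⟩ := h.bddAbove
  refine ⟨N, fun i hi => ?_⟩
  by_contra hc
  exact absurd (hN hc) (not_le.2 hi)

theorem FinSupp.finite_inversions {w : Perm ℕ+} (h : FinSupp w) : (inversions w).Finite := by
  obtain ⟨N, hN⟩ := h.exists_bound
  refine ((Set.finite_Iic N).prod (Set.finite_Iic N)).subset ?_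
  rintro ⟨i, j⟩ ⟨h1, h2⟩
  have hj : j ≤ N := by
    by_contra! hj
    dsimp only at h1 h2
    rw [hN j hj] at h2
    have := w.injective (hN _ (hj.trans h2))
    order
  exact ⟨h1.le.trans hj, hj⟩

/-- The transposition `(a b)` acts on increasing pairs, whenever the image is increasing. -/
def flipPair (a b : ℕ+) (p : ℕ+ × ℕ+) : ℕ+ × ℕ+ :=
  if swap a b p.1 < swap a b p.2 then (swap a b p.1, swap a b p.2) else p

theorem flipPair_flipPair {a b : ℕ+} {p : ℕ+ × ℕ+} (hp : p.1 < p.2) :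
    flipPair a b (flipPair a b p) = p := by
  unfold flipPair
  by_cases h : swap a b p.1 < swap a b p.2
  · simp [h, hp]
  · simp [h]

theorem pair_cases {a b i j : ℕ+} (hab : a < b) (hij : i < j)
    (h : ¬ swap a b i < swap a b j) :
    (i = a ∧ j = b) ∨ (i = a ∧ a < j ∧ j < b) ∨ (j = b ∧ a < i ∧ i < b) := by
  rcases eq_or_ne i a with rfl | h1
  · rw [swap_apply_left] at h
    rcases eq_or_ne j b with rfl | h2
    · exact .inl ⟨rfl, rfl⟩
    · rw [swap_apply_of_ne_of_ne hij.ne' h2] at h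
      exact .inr (.inl ⟨rfl, hij, lt_of_le_of_ne (not_lt.1 h) h2⟩)
  rcases eq_or_ne i b with rfl | h2
  · rw [swap_apply_right, swap_apply_of_ne_of_ne (hab.trans hij).ne' hij.ne'] at h
    exact absurd (hab.trans hij) h
  rw [swap_apply_of_ne_of_ne h1 h2] at h
  rcases eq_or_ne j a with rfl | h3
  · rw [swap_apply_left] at h
    exact absurd (hij.trans hab) h
  rcases eq_or_ne j b with rfl | h4
  · rw [swap_apply_right] at h
    exact .inr (.inr ⟨rfl, lt_of_le_of_ne (not_lt.1 h) h1.symm, hij⟩)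
  · rw [swap_apply_of_ne_of_ne h3 h4] at h
    exact absurd hij h

theorem flipPair_mem {w : Perm ℕ+} {a b : ℕ+} (hab : a < b) (hw : w a < w b) {p : ℕ+ × ℕ+}
    (hp : p ∈ inversions w) :
    flipPair a b p ∈ inversions (w * swap a b) \ {(a, b)} := by
  obtain ⟨i, j⟩ := p
  obtain ⟨hij, hwij⟩ := hp
  dsimp only at hij hwij
  unfold flipPair
  by_cases h : swap a b i < swap a b j
  · simp only [h, if_true]
    refine ⟨⟨h, by simpa using hwij⟩, fun e => ?_⟩
    simp only [Set.mem_singleton_iff, Prod.mk.injEq] at e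
    have e1 : i = b := by simpa using congrArg (swap a b) e.1
    have e2 : j = a := by simpa using congrArg (swap a b) e.2
    order
  · simp only [h, if_false]
    rcases pair_cases hab hij h with ⟨rfl, rfl⟩ | ⟨rfl, h1, h2⟩ | ⟨rfl, h1, h2⟩
    · exact absurd hwij (not_lt.2 hw.le)
    · refine ⟨⟨hij, ?_⟩, fun e => h2.ne (congrArg Prod.snd e)⟩
      simp only [Perm.mul_apply, swap_apply_left]
      rw [swap_apply_of_ne_of_ne h1.ne' h2.ne]
      exact hwij.trans hw
    · refine ⟨⟨hij, ?_⟩, fun e => h1.ne' (congrArg Prod.fst e)⟩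
      simp only [Perm.mul_apply, swap_apply_right]
      rw [swap_apply_of_ne_of_ne h1.ne' h2.ne]
      exact hw.trans hwij

theorem mem_inversions_swap {w : Perm ℕ+} {a b : ℕ+} (hab : a < b) (hw : w a < w b) :
    (a, b) ∈ inversions (w * swap a b) := ⟨hab, by simpa using hw⟩

theorem injOn_flipPair (w : Perm ℕ+) (a b : ℕ+) : Set.InjOn (flipPair a b) (inversions w) :=
  fun p hp q hq h => by rw [← flipPair_flipPair (a := a) (b := b) hp.1, h, flipPair_flipPair hq.1]

/-- `flipPair` injects the inversions of `w` into those of the product, and misses `(a, b)`. -/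
theorem ncard_inversions_lt {w : Perm ℕ+} (hf : FinSupp w) {a b : ℕ+} (hab : a < b)
    (hw : w a < w b) : (inversions w).ncard + 1 ≤ (inversions (w * swap a b)).ncard := by
  have hfin := (hf.mul_swap a b).finite_inversions
  rw [← Set.ncard_sdiff_singleton_add_one (mem_inversions_swap hab hw) hfin, Nat.add_le_add_iff_right]
  exact Set.ncard_le_ncard_of_injOn _ (fun p hp => flipPair_mem hab hw hp) (injOn_flipPair w a b)
    (hfin.subset Set.sdiff_subset)

theorem ncard_inversions_eq {w : Perm ℕ+} (hf : FinSupp w) {a b : ℕ+} (hab : a < b)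
    (hw : w a < w b) (hb : ∀ c, a < c → c < b → ¬ (w a < w c ∧ w c < w b)) :
    (inversions (w * swap a b)).ncard = (inversions w).ncard + 1 := by
  have hfin := (hf.mul_swap a b).finite_inversions
  refine le_antisymm ?_ (ncard_inversions_lt hf hab hw)
  rw [← Set.ncard_sdiff_singleton_add_one (mem_inversions_swap hab hw) hfin, Nat.add_le_add_iff_right]
  refine Set.ncard_le_ncard_of_injOn (flipPair a b) ?_
    ((injOn_flipPair _ a b).mono Set.sdiff_subset) hf.finite_inversions
  rintro ⟨i, j⟩ ⟨⟨hij, hwij⟩, hne⟩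
  dsimp only [Perm.mul_apply] at hij hwij
  unfold flipPair
  by_cases h : swap a b i < swap a b j
  · simp only [h, if_true]
    exact ⟨h, hwij⟩
  · simp only [h, if_false]
    rcases pair_cases hab hij h with ⟨rfl, rfl⟩ | ⟨rfl, h1, h2⟩ | ⟨rfl, h1, h2⟩
    · exact absurd rfl hne
    · rw [swap_apply_left, swap_apply_of_ne_of_ne h1.ne' h2.ne] at hwij
      refine ⟨hij, lt_of_le_of_ne (not_lt.1 fun h => hb j h1 h2 ⟨h, hwij⟩) fun e => ?_⟩
      exact h1.ne' (w.injective e)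
    · rw [swap_apply_right, swap_apply_of_ne_of_ne h1.ne' h2.ne] at hwij
      refine ⟨hij, lt_of_le_of_ne (not_lt.1 fun h => hb i h1 h2 ⟨hwij, h⟩) fun e => ?_⟩
      exact h2.ne' (w.injective e)

/-- The pair `(a, c)` is a second inversion outside the image: `flipPair` fixes it, and it is no
inversion of `w`. -/
theorem ncard_inversions_lt_of_between {w : Perm ℕ+} (hf : FinSupp w) {a b c : ℕ+}
    (hw : w a < w b) (hac : a < c) (hcb : c < b) (hwac : w a < w c) (hwcb : w c < w b) :
    (inversions w).ncard + 1 < (inversions (w * swap a b)).ncard := by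
  have hab := hac.trans hcb
  have hfin := (hf.mul_swap a b).finite_inversions
  have hmem : (a, c) ∈ inversions (w * swap a b) \ {(a, b)} := by
    refine ⟨⟨hac, ?_⟩, fun e => hcb.ne (congrArg Prod.snd e)⟩
    simp only [Perm.mul_apply, swap_apply_left]
    rwa [swap_apply_of_ne_of_ne hac.ne' hcb.ne]
  have hfin' := hfin.subset (Set.sdiff_subset (t := {(a, b)}))
  rw [← Set.ncard_sdiff_singleton_add_one (mem_inversions_swap hab hw) hfin,
    ← Set.ncard_sdiff_singleton_add_one hmem hfin', Nat.add_lt_add_iff_right, Nat.lt_succ_iff]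
  refine Set.ncard_le_ncard_of_injOn _ (fun p hp => ⟨flipPair_mem hab hw hp, fun e => ?_⟩)
    (injOn_flipPair w a b) (hfin'.subset Set.sdiff_subset)
  have hp' := flipPair_flipPair (a := a) (b := b) hp.1
  rw [Set.mem_singleton_iff.1 e] at hp'
  have : flipPair a b (a, c) = (a, c) := by
    unfold flipPair
    simp only [swap_apply_left]
    rw [swap_apply_of_ne_of_ne hac.ne' hcb.ne, if_neg (not_lt.2 hcb.le)]
  rw [this] at hp'
  rw [← hp'] at hp
  exact absurd hp.2 (not_lt.2 hwac.le)

theorem ncard_inversions_iff {w : Perm ℕ+} (hf : FinSupp w) {a b : ℕ+} (hab : a < b) :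
    (inversions (w * swap a b)).ncard = (inversions w).ncard + 1 ↔
      w a < w b ∧ ∀ c, a < c → c < b → ¬ (w a < w c ∧ w c < w b) := by
  refine ⟨fun h => ?_, fun h => ncard_inversions_eq hf hab h.1 h.2⟩
  have hw : w a < w b := by
    by_contra! hw
    have hw' : w b < w a := lt_of_le_of_ne hw fun e => hab.ne' (w.injective e)
    have := ncard_inversions_lt (hf.mul_swap a b) hab (by simpa using hw')
    rw [mul_assoc, swap_mul_self, mul_one] at this
    omega
  exact ⟨hw, fun c h1 h2 h3 => absurd h
    (ncard_inversions_lt_of_between hf hw h1 h2 h3.1 h3.2).ne'⟩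

end Length

end UniversalBruhat

namespace UniversalBruhat

open Equiv

/-! ### Legal chains, k-Bruhat chains and rank -/

section Chains

theorem finSupp_val (w : SInf) : FinSupp w.1 := w.2

theorem length_mul_transp_iff {w : SInf} {a b : ℕ+} (hab : a < b) :
    length (w * transp a b) = length w + 1 ↔
      w.1 a < w.1 b ∧ ∀ c, a < c → c < b → ¬ (w.1 a < w.1 c ∧ w.1 c < w.1 b) :=
  ncard_inversions_iff (finSupp_val w) hab

/-- The permutation `u` allows every chain of the universal order from the identity to `ζ` to be
lifted to a chain of the `k`-Bruhat order above `u`. -/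
structure Compat (k : ℕ) (u ζ : Perm ℕ+) : Prop where
  left {i : ℕ+} (hi : (i : ℕ) ≤ k) : u i ≤ ζ (u i)
  right {i : ℕ+} (hi : k < (i : ℕ)) : ζ (u i) ≤ u i
  anti_left {i j : ℕ+} (hij : i < j) (hj : (j : ℕ) ≤ k) : u j < u i
  anti_right {i j : ℕ+} (hi : k < (i : ℕ)) (hij : i < j) (hj : ζ (u j) ≠ u j) : u j < u i

/-- Undoing a legal letter keeps the direction in which values are displaced, and a value fixed
after the letter was already fixed before it. -/
theorem Compat.of_legal {k : ℕ} {u ζ : Perm ℕ+} {a b : ℕ+} (h : Compat k u (swap a b * ζ))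
    (hl : Legal ζ⁻¹ a b) : Compat k u ζ := by
  obtain ⟨hab, ha, hb, -⟩ := hl
  have hinv : ∀ v, ζ⁻¹ (ζ v) = v := ζ.symm_apply_apply
  have key : ∀ v, (ζ v = a ∧ v ≤ a ∧ (swap a b * ζ) v = b) ∨ (ζ v = b ∧ b ≤ v ∧
      (swap a b * ζ) v = a) ∨ (swap a b * ζ) v = ζ v := fun v => by
    by_cases h1 : ζ v = a
    · refine .inl ⟨h1, ?_, by simp [h1]⟩
      rwa [← h1, hinv, h1] at ha
    by_cases h2 : ζ v = b
    · refine .inr (.inl ⟨h2, ?_, by simp [h2]⟩)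
      rwa [← h2, hinv, h2] at hb
    · exact .inr (.inr (by rw [Perm.mul_apply, swap_apply_of_ne_of_ne h1 h2]))
  refine ⟨fun {i} hi => ?_, fun {i} hi => ?_, h.anti_left, fun {i j} hi hij hj =>
    h.anti_right hi hij fun e => ?_⟩
  · have := h.left hi
    rcases key (u i) with ⟨h1, h2, h3⟩ | ⟨h1, h2, h3⟩ | h3 <;> rw [h3] at this <;> order
  · have := h.right hi
    rcases key (u i) with ⟨h1, h2, h3⟩ | ⟨h1, h2, h3⟩ | h3 <;> rw [h3] at this <;> order
  · rcases key (u j) with ⟨h1, h2, h3⟩ | ⟨h1, h2, h3⟩ | h3 <;> rw [h3] at e <;> order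

/-- Displacement directions put `a` at a position `i ≤ k` and `b` at `j > k`. An obstructing
position between them would by legality have its `u`-value between `u i` and `u j`, against the
decrease of `u` on its side of `k`. -/
theorem Compat.kCover {k : ℕ} {u ζ : SInf} {a b : ℕ+} (h : Compat k u.1 (swap a b * ζ.1))
    (hl : Legal ζ.1⁻¹ a b) : KCover k (ζ * u) (transp a b * ζ * u) := by
  have h0 := h.of_legal hl
  obtain ⟨hab, ha, hb, hbet⟩ := hl
  obtain ⟨i, hi⟩ : ∃ i, (ζ * u).1 i = a := (ζ * u).1.surjective a
  obtain ⟨j, hj⟩ : ∃ j, (ζ * u).1 j = b := (ζ * u).1.surjective b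
  have hinv : ∀ c, ζ.1⁻¹ ((ζ * u).1 c) = u.1 c := fun c => ζ.1.symm_apply_apply _
  have hi' : ζ.1 (u.1 i) = a := hi
  have hj' : ζ.1 (u.1 j) = b := hj
  rw [← hi, hinv, hi] at ha
  rw [← hj, hinv, hj] at hb
  have hik : (i : ℕ) ≤ k := by
    by_contra! hk
    have := h.right hk
    rw [Perm.mul_apply, hi', swap_apply_left] at this
    order
  have hjk : k < (j : ℕ) := by
    by_contra! hk
    have := h.left hk
    rw [Perm.mul_apply, hj', swap_apply_right] at this
    order
  have hij : i < j := by
    rw [← PNat.coe_lt_coe]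
    omega
  have hw : transp a b * ζ * u = ζ * u * transp i j := by
    apply Subtype.ext
    have := mul_swap_eq_swap_mul (ζ * u).1 i j
    rw [hi, hj] at this
    rw [mul_assoc]
    exact this.symm
  refine ⟨i, j, hik, hjk, hw, ?_⟩
  rw [hw, length_mul_transp_iff hij, hi, hj]
  refine ⟨hab, fun c h1 h2 ⟨h3, h4⟩ => ?_⟩
  have h5 := hbet _ h3 h4
  rw [hinv c, ← hi, hinv, ← hj, hinv] at h5
  rcases le_or_gt (c : ℕ) k with hc | hc
  · exact absurd h5.1 (not_lt.2 (h0.anti_left h1 hc).le)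
  · refine absurd h5.2 (not_lt.2 (h.anti_right hc h2 ?_).le)
    rw [Perm.mul_apply, hj', swap_apply_right]
    exact (hab.trans_le hb).ne

variable {M : Type*} [MonoidWithZero M]

theorem Reach.kLe {U : ℕ+ → ℕ+ → M} {n : ℕ} {x : M} {π : Perm ℕ+} (h : Reach U n x π)
    {k : ℕ} {u ζ : SInf} (hζ : ζ.1⁻¹ = π) (hc : Compat k u.1 ζ.1) :
    KLe k u (ζ * u) ∧ length (ζ * u) = length u + n := by
  induction h generalizing ζ with
  | one =>
    have : ζ = 1 := Subtype.ext (inv_eq_one.1 hζ)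
    subst this
    rw [one_mul]
    exact ⟨.refl, rfl⟩
  | @step n x π a b h hl ih =>
    have hζ' : (transp a b * ζ).1⁻¹ = π := by
      have : (transp a b * ζ).1⁻¹ = ζ.1⁻¹ * (swap a b)⁻¹ := mul_inv_rev _ _
      rw [this, hζ, swap_inv, mul_assoc, swap_mul_self, mul_one]
    have hζ0 : transp a b * (transp a b * ζ) = ζ :=
      Subtype.ext (swap_mul_self_mul a b ζ.1)
    have hc' : Compat k u.1 (swap a b * (transp a b * ζ).1) := by
      have : swap a b * (transp a b * ζ).1 = ζ.1 := congrArg Subtype.val hζ0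
      rwa [this]
    have hl' : Legal (transp a b * ζ).1⁻¹ a b := by rwa [hζ']
    obtain ⟨h1, h2⟩ := ih hζ' (hc'.of_legal hl')
    have h3 := hc'.kCover hl'
    rw [hζ0] at h3
    refine ⟨h1.tail h3, ?_⟩
    obtain ⟨_, _, _, _, _, h4⟩ := h3
    rw [h4, h2, add_assoc]

/-- Let `u` list first the values that `ζ` raises, then the other values up to `N`, each block
decreasing, and be the identity beyond `N`; `k` is the size of the first block. -/
theorem exists_compat (ζ : SInf) : ∃ (k : ℕ) (u : SInf), Compat k u.1 ζ.1 := by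
  obtain ⟨N, hN⟩ := (finSupp_val ζ).exists_bound
  let e : Fin N ≃ {x : ℕ+ // x ≤ N} :=
    { toFun := fun i => ⟨Nat.succPNat i, (PNat.coe_le_coe _ _).1 i.2⟩
      invFun := fun x => ⟨(x.1 : ℕ) - 1, by
        have h1 := x.1.pos
        have h2 : (x.1 : ℕ) ≤ N := x.2
        omega⟩
      left_inv := fun i => by ext; rfl
      right_inv := fun x => by
        have h1 : 1 ≤ (x.1 : ℕ) := x.1.pos
        exact Subtype.ext (PNat.eq (Nat.sub_add_cancel h1)) }
  have he : ∀ i, ((e i : ℕ+) : ℕ) = i + 1 := fun i => rfl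
  classical
  -- Raised values get keys below `N`, the others keys at least `N`; within a class larger values
  -- get smaller keys.
  let key : Fin N → ℕ := fun i =>
    (if (e i : ℕ+) < ζ.1 (e i) then 0 else (N : ℕ)) + (N - (i + 1))
  have hkey : Function.Injective key := by
    intro i j hij
    have h1 := i.2
    have h2 := j.2
    dsimp only [key] at hij
    ext
    split_ifs at hij <;> omega
  let σ := Tuple.sort key
  have hσ : StrictMono (key ∘ σ) :=
    (Tuple.monotone_sort key).strictMono_of_injective (hkey.comp σ.injective)
  obtain ⟨k, hkN, hk⟩ : ∃ k ≤ (N : ℕ), ∀ i : Fin N,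
      (i : ℕ) < k ↔ (e (σ i) : ℕ+) < ζ.1 (e (σ i)) := by
    -- `k` is the first sorted index whose value is not raised, or `N` if there is none.
    by_cases hall : ∃ m, ∃ h : m < (N : ℕ), ¬ (e (σ ⟨m, h⟩) : ℕ+) < ζ.1 (e (σ ⟨m, h⟩))
    · obtain ⟨m, ⟨hm, hm'⟩, hmin⟩ := Nat.findX hall
      refine ⟨m, hm.le, fun i => ⟨fun hi => ?_, fun hi => ?_⟩⟩
      · by_contra hc
        exact hmin i hi ⟨i.2, hc⟩
      · by_contra! hc
        have hle : key (σ ⟨_, hm⟩) ≤ key (σ i) :=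
          hσ.monotone (Fin.le_def.2 hc : (⟨_, hm⟩ : Fin N) ≤ i)
        have h2 := (σ i).2
        dsimp only [key] at hle
        rw [if_neg hm', if_pos hi] at hle
        omega
    · push Not at hall
      exact ⟨N, le_rfl, fun i => ⟨fun _ => hall i i.2, fun _ => i.2⟩⟩
  let u : Perm ℕ+ := σ.extendDomain e
  have hu : ∀ i, u (e i) = e (σ i) := fun i => σ.extendDomain_apply_image e i
  have hu' : ∀ i, N < i → u i = i := fun i hi =>
    σ.extendDomain_apply_not_subtype e (not_le.2 hi)
  have hanti : ∀ i j : Fin N, i < j →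
      ((e (σ i) : ℕ+) < ζ.1 (e (σ i)) ↔ (e (σ j) : ℕ+) < ζ.1 (e (σ j))) →
      (e (σ j) : ℕ+) < e (σ i) := by
    intro i j hij hiff
    have hlt : key (σ i) < key (σ j) := hσ hij
    have h1 := (σ i).2
    have h2 := (σ j).2
    dsimp only [key] at hlt
    rw [← PNat.coe_lt_coe, he, he]
    split_ifs at hlt <;> first | omega | tauto
  have hex : ∀ i : ℕ+, i ≤ N → ∃ i', i = e i' := fun i hi =>
    ⟨e.symm ⟨i, hi⟩, by rw [e.apply_symm_apply]⟩
  refine ⟨k, ⟨u, (Set.finite_Iic N).subset fun i hi => ?_⟩, ⟨?_, ?_, ?_, ?_⟩⟩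
  · by_contra hc
    exact hi (hu' i (not_le.1 hc))
  · intro i hi
    obtain ⟨i, rfl⟩ := hex i (by rw [← PNat.coe_le_coe]; omega)
    change u _ ≤ ζ.1 (u _)
    rw [hu]
    rw [he] at hi
    exact ((hk i).1 hi).le
  · intro i hi
    change ζ.1 (u _) ≤ u _
    rcases le_or_gt i N with hiN | hiN
    · obtain ⟨i, rfl⟩ := hex i hiN
      rw [hu]
      rw [he] at hi
      exact not_lt.1 fun h => absurd ((hk i).2 h) (by omega)
    · rw [hu' i hiN, hN i hiN]
  · intro i j hij hj
    have hij' : (i : ℕ) < j := hij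
    obtain ⟨i, rfl⟩ := hex i (by rw [← PNat.coe_le_coe]; omega)
    obtain ⟨j, rfl⟩ := hex j (by rw [← PNat.coe_le_coe]; omega)
    change u _ < u _
    rw [hu, hu]
    rw [he] at hj hij'
    rw [he] at hij'
    refine hanti i j (by rw [Fin.lt_def]; omega) ?_
    rw [← hk, ← hk]
    omega
  · intro i j hi hij hj
    have hij' : (i : ℕ) < j := hij
    change ζ.1 (u _) ≠ u _ at hj
    have hjN : j ≤ N := by
      by_contra! hc
      exact hj (by rw [hu' j hc, hN j hc])
    obtain ⟨i, rfl⟩ := hex i (hij.le.trans hjN)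
    obtain ⟨j, rfl⟩ := hex j hjN
    change u _ < u _
    rw [hu, hu]
    rw [he] at hi hij'
    rw [he] at hij'
    refine hanti i j (by rw [Fin.lt_def]; omega) ?_
    rw [← hk, ← hk]
    omega

/-- The invariants of chains of the `k`-Bruhat order from `u` to `v`. -/
structure Above (k : ℕ) (u v : Perm ℕ+) : Prop where
  left {i : ℕ+} (hi : (i : ℕ) ≤ k) : u i ≤ v i
  right {i : ℕ+} (hi : k < (i : ℕ)) : v i ≤ u i
  mono_left {i j : ℕ+} (hij : i < j) (hj : (j : ℕ) ≤ k) (h : u i < u j) : v i < v j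
  mono_right {i j : ℕ+} (hi : k < (i : ℕ)) (hij : i < j) (h : u i < u j) : v i < v j

/-- Monotonicity on a side of `k` could break only if an exchanged value jumped over one between,
which `hbet` forbids. -/
theorem Above.mul_swap {k : ℕ} {u v : Perm ℕ+} (h : Above k u v) {a b : ℕ+}
    (ha : (a : ℕ) ≤ k) (hb : k < (b : ℕ)) (hv : v a < v b)
    (hbet : ∀ c, a < c → c < b → ¬ (v a < v c ∧ v c < v b)) : Above k u (v * swap a b) := by
  have hl : ∀ i : ℕ+, (i : ℕ) ≤ k → i ≠ b := fun i hi e => by subst e; omega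
  have hr : ∀ i : ℕ+, k < (i : ℕ) → i ≠ a := fun i hi e => by subst e; omega
  have hlt : ∀ i j : ℕ+, (i : ℕ) ≤ k → k < (j : ℕ) → i < j := fun i j hi hj => by
    rw [← PNat.coe_lt_coe]; omega
  have sl : ∀ i : ℕ+, (i : ℕ) ≤ k → i ≠ a → (v * swap a b) i = v i := fun i hi hia => by
    rw [Perm.mul_apply, swap_apply_of_ne_of_ne hia (hl i hi)]
  have sr : ∀ i : ℕ+, k < (i : ℕ) → i ≠ b → (v * swap a b) i = v i := fun i hi hib => by
    rw [Perm.mul_apply, swap_apply_of_ne_of_ne (hr i hi) hib]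
  have sa : (v * swap a b) a = v b := by simp
  have sb : (v * swap a b) b = v a := by simp
  refine ⟨fun {i} hi => ?_, fun {i} hi => ?_, fun {i j} hij hj huv => ?_,
    fun {i j} hi hij huv => ?_⟩
  · have h1 := h.left hi
    rcases eq_or_ne i a with rfl | hia
    · rw [sa]; order
    · rwa [sl i hi hia]
  · have h1 := h.right hi
    rcases eq_or_ne i b with rfl | hib
    · rw [sb]; order
    · rwa [sr i hi hib]
  · have h1 := h.mono_left hij hj huv
    have hi : (i : ℕ) ≤ k := (PNat.coe_lt_coe _ _ |>.2 hij).le.trans hj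
    rcases eq_or_ne i a with rfl | hia
    · rw [sa, sl j hj hij.ne']
      refine lt_of_le_of_ne (not_lt.1 fun hc => hbet j hij (hlt j b hj hb) ⟨h1, hc⟩) fun e => ?_
      exact hl j hj (v.injective e).symm
    · rw [sl i hi hia]
      rcases eq_or_ne j a with rfl | hja
      · rw [sa]; order
      · rwa [sl j hj hja]
  · have h1 := h.mono_right hi hij huv
    have hj : k < (j : ℕ) := hi.trans (PNat.coe_lt_coe _ _ |>.2 hij)
    rcases eq_or_ne j b with rfl | hjb
    · rw [sb, sr i hi hij.ne]
      refine lt_of_le_of_ne (not_lt.1 fun hc => hbet i (hlt a i ha hi) hij ⟨hc, h1⟩) fun e => ?_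
      exact hr i hi (v.injective e)
    · rw [sr j hj hjb]
      rcases eq_or_ne i b with rfl | hib
      · rw [sb]; order
      · rwa [sr i hi hib]

/-- A position `c` with `v c` between `v a` and `v b` lies before `a` or after `b`. One bound on `u
c` comes from the displacement directions, the other from monotonicity on that side of `k`. -/
theorem Above.legal {k : ℕ} {u v : Perm ℕ+} (h : Above k u v) {a b : ℕ+}
    (ha : (a : ℕ) ≤ k) (hb : k < (b : ℕ)) (hv : v a < v b)
    (hbet : ∀ c, a < c → c < b → ¬ (v a < v c ∧ v c < v b)) :
    Legal (u * v⁻¹) (v a) (v b) := by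
  have hinv : ∀ c, (u * v⁻¹) (v c) = u c := fun c => by simp
  refine ⟨hv, by rw [hinv]; exact h.left ha, by rw [hinv]; exact h.right hb, fun c h1 h2 => ?_⟩
  obtain ⟨c, rfl⟩ := v.surjective c
  rw [hinv, hinv, hinv]
  have hca : c ≠ a := by rintro rfl; order
  have hcb : c ≠ b := by rintro rfl; order
  have hua : u c ≠ u a := fun e => hca (u.injective e)
  have hub : u c ≠ u b := fun e => hcb (u.injective e)
  have hl := h.left ha
  have hr := h.right hb
  rcases lt_or_gt_of_ne hca with hc | hc
  · have hck : (c : ℕ) ≤ k := (PNat.coe_lt_coe _ _ |>.2 hc).le.trans ha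
    have h4 := h.left hck
    refine ⟨?_, by order⟩
    by_contra! h5
    have := h.mono_left hc ha (lt_of_le_of_ne h5 hua)
    order
  · have hbc : b < c := by
      by_contra! h5
      exact hbet c hc (lt_of_le_of_ne h5 hcb) ⟨h1, h2⟩
    have hck : k < (c : ℕ) := hb.trans (PNat.coe_lt_coe _ _ |>.2 hbc)
    have h4 := h.right hck
    refine ⟨by order, ?_⟩
    by_contra! h5
    have := h.mono_right hb hbc (lt_of_le_of_ne h5 hub.symm)
    order

theorem KLe.exists_reach (U : ℕ+ → ℕ+ → M) {k : ℕ} {u v : SInf} (h : KLe k u v) :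
    ∃ n x, Reach U n x (u.1 * v.1⁻¹) ∧ length v = length u + n ∧ Above k u.1 v.1 := by
  induction h with
  | refl =>
    refine ⟨0, 1, ?_, rfl, ⟨fun _ => le_rfl, fun _ => le_rfl, fun _ _ h => h, fun _ _ h => h⟩⟩
    rw [mul_inv_cancel]
    exact .one
  | @tail v w _ hc ih =>
    obtain ⟨n, x, h1, h2, h3⟩ := ih
    obtain ⟨a, b, ha, hb, rfl, hlen⟩ := hc
    have hab : a < b := by
      rw [← PNat.coe_lt_coe]
      omega
    obtain ⟨hv, hbet⟩ := (length_mul_transp_iff hab).1 hlen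
    refine ⟨n + 1, U (v.1 a) (v.1 b) * x, ?_, by rw [hlen, h2, add_assoc],
      h3.mul_swap ha hb hv hbet⟩
    have : u.1 * (v * transp a b).1⁻¹ = u.1 * v.1⁻¹ * swap (v.1 a) (v.1 b) := by
      have e1 : (v * transp a b).1⁻¹ = (swap a b)⁻¹ * v.1⁻¹ := mul_inv_rev _ _
      rw [e1, swap_inv, swap_apply_apply]
      group
    rw [this]
    exact h1.step (h3.legal ha hb hv hbet)

/-- The infimum is attained by a chain over some `u'`. Rewritten in legal letters, it lifts over the
same compatible `u` as the given word, so both letter counts are the same difference of lengths. -/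
theorem Reach.uLength_eq {U : ℕ+ → ℕ+ → M} {n : ℕ} {x : M} {ζ : SInf}
    (h : Reach U n x ζ.1⁻¹) : uLength ζ = n := by
  obtain ⟨k, u, hc⟩ := exists_compat ζ
  obtain ⟨h1, h2⟩ := h.kLe rfl hc
  have hne : {n | ∃ (u : SInf) (k : ℕ), KLe k u (ζ * u) ∧ length (ζ * u) = length u + n}.Nonempty :=
    ⟨n, u, k, h1, h2⟩
  obtain ⟨u', k', h3, h4⟩ := Nat.sInf_mem hne
  obtain ⟨n', x', h5, h6, -⟩ := h3.exists_reach U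
  have e : u'.1 * (ζ * u').1⁻¹ = ζ.1⁻¹ := by
    have : (ζ * u').1⁻¹ = u'.1⁻¹ * ζ.1⁻¹ := mul_inv_rev _ _
    rw [this, mul_inv_cancel_left]
  rw [e] at h5
  have h7 := (h5.kLe rfl hc).2
  change sInf _ = n
  omega

/-- A pair `u`, `k` compatible with the upper permutation also serves the lower one. -/
theorem Reach.covers {U : ℕ+ → ℕ+ → M} {n : ℕ} {x : M} {ζ : SInf} (h : Reach U n x ζ.1⁻¹)
    {a b : ℕ+} (hl : Legal ζ.1⁻¹ a b) :
    ULe ζ (transp a b * ζ) ∧ uLength (transp a b * ζ) = uLength ζ + 1 := by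
  have h' : Reach U (n + 1) (U a b * x) (transp a b * ζ).1⁻¹ := by
    have : (transp a b * ζ).1⁻¹ = ζ.1⁻¹ * (swap a b)⁻¹ := mul_inv_rev _ _
    rw [this, swap_inv]
    exact h.step hl
  rw [h.uLength_eq, h'.uLength_eq]
  obtain ⟨k, u, hc⟩ := exists_compat (transp a b * ζ)
  have hc0 : Compat k u.1 ζ.1 := Compat.of_legal hc hl
  exact ⟨⟨u, k, (h.kLe rfl hc0).1, .single (Compat.kCover hc hl)⟩, rfl⟩

end Chains

end UniversalBruhat

namespace UniversalBruhat

open Equiv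

/-! ### The presented monoid and the comparison with the operators -/

section Presentation

noncomputable instance : MonoidWithZero modRel.Quotient where
  zero := ((0 : FreeWords) : modRel.Quotient)
  zero_mul x := by
    induction x using Con.induction_on with
    | H x => exact congrArg _ (zero_mul x)
  mul_zero x := by
    induction x using Con.induction_on with
    | H x => exact congrArg _ (mul_zero x)

open Classical in
/-- The letters of the presented monoid. -/
noncomputable def genU (a b : ℕ+) : modRel.Quotient :=
  -- The value `0` is a filler: the relations involve increasing pairs of indices only.
  if h : a < b then ((letter h : FreeWords) : modRel.Quotient) else 0

theorem genU_of_lt {a b : ℕ+} (h : a < b) :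
    genU a b = ((letter h : FreeWords) : modRel.Quotient) := dif_pos h

theorem quotient_eq_of_rel {x y : FreeWords} (h : Rel x y) :
    (x : modRel.Quotient) = (y : modRel.Quotient) :=
  (Con.eq _).2 (ConGen.Rel.of _ _ h)

theorem rels_genU : Rels genU where
  braid_left h1 h2 h3 := by
    rw [genU_of_lt h1, genU_of_lt h2, genU_of_lt h3, genU_of_lt (h1.trans h2),
      genU_of_lt (h2.trans h3)]
    exact quotient_eq_of_rel (.braid_left h1 h2 h3)
  braid_right h1 h2 h3 := by
    rw [genU_of_lt h1, genU_of_lt h2, genU_of_lt h3, genU_of_lt (h1.trans h2),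
      genU_of_lt (h2.trans h3)]
    exact quotient_eq_of_rel (.braid_right h1 h2 h3)
  comm_disj h1 h2 h3 := by
    rw [genU_of_lt h1, genU_of_lt h3]
    exact quotient_eq_of_rel (.comm h1 h3 (.inl h2))
  comm_nest h1 h2 h3 := by
    rw [genU_of_lt (h1.trans (h2.trans h3)), genU_of_lt h2]
    exact quotient_eq_of_rel (.comm _ h2 (.inr ⟨h1, h3⟩))
  cross_left h1 h2 h3 := by
    rw [genU_of_lt (h1.trans_lt h2), genU_of_lt (h2.trans_le h3)]
    exact quotient_eq_of_rel (.cross_left h1 h2 h3)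
  cross_right h1 h2 h3 := by
    rw [genU_of_lt (h1.trans_lt h2), genU_of_lt (h2.trans_le h3)]
    exact quotient_eq_of_rel (.cross_right h1 h2 h3)
  aba_left h1 h2 := by
    rw [genU_of_lt h1, genU_of_lt h2]
    exact quotient_eq_of_rel (.aba_left h1 h2)
  aba_right h1 h2 := by
    rw [genU_of_lt h1, genU_of_lt h2]
    exact quotient_eq_of_rel (.aba_right h1 h2)

/-- The head of the list acts last. While letters are legal both products advance together; the
first illegal letter makes the presented product zero, which then persists. -/
theorem reach_or_eq_zero (W : List Idx) :
    (∃ ζ : SInf, Reach genU W.length (W.map fun g => genU g.fst g.snd).prod ζ.1⁻¹ ∧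
      (W.map uHat).prod (Finsupp.single 1 1) = Finsupp.single ζ 1) ∨
    (W.map fun g => genU g.fst g.snd).prod = 0 := by
  induction W with
  | nil => exact .inl ⟨1, .one, rfl⟩
  | cons g W ih =>
    simp only [List.map_cons, List.prod_cons, List.length_cons]
    rcases ih with ⟨ζ, h1, h2⟩ | h
    · by_cases hl : Legal ζ.1⁻¹ g.fst g.snd
      · refine .inl ⟨transp g.fst g.snd * ζ, ?_, ?_⟩
        · have : (transp g.fst g.snd * ζ).1⁻¹ = ζ.1⁻¹ * (swap g.fst g.snd)⁻¹ := mul_inv_rev _ _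
          rw [this, swap_inv]
          exact h1.step hl
        · rw [Module.End.mul_apply, h2, uHat, Finsupp.linearCombination_single, one_smul,
            if_pos (h1.covers hl)]
      · exact .inr (vanish rels_genU _ h1 g.lt hl)
    · exact .inr (by rw [h, mul_zero])

end Presentation

end UniversalBruhat

theorem mainTheorem3 (n : ℕ) (α β : Fin n → ℕ+) (h : ∀ i, α i < β i)
    (hx : (List.ofFn fun i => UniversalBruhat.uHat ⟨α i, β i, h i⟩).reverse.prod
      (Finsupp.single 1 1) = 0) :
    UniversalBruhat.modRel
      (List.ofFn fun i => UniversalBruhat.letter (h i)).reverse.prod 0 := by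
  have e1 : (List.ofFn fun i => UniversalBruhat.uHat ⟨α i, β i, h i⟩).reverse =
      (List.ofFn fun i => (⟨α i, β i, h i⟩ : UniversalBruhat.Idx)).reverse.map
        UniversalBruhat.uHat := by
    rw [List.map_reverse, List.map_ofFn]
    rfl
  have e2 : (List.ofFn fun i => UniversalBruhat.letter (h i)).reverse.map
        UniversalBruhat.modRel.mk' =
      (List.ofFn fun i => (⟨α i, β i, h i⟩ : UniversalBruhat.Idx)).reverse.map
        fun g => UniversalBruhat.genU g.fst g.snd := by
    rw [List.map_reverse, List.map_reverse, List.map_ofFn, List.map_ofFn]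
    congr 2
    funext i
    exact (UniversalBruhat.genU_of_lt (h i)).symm
  rw [e1] at hx
  rw [← Con.eq]
  change UniversalBruhat.modRel.mk' _ = 0
  rw [map_list_prod, e2]
  rcases UniversalBruhat.reach_or_eq_zero
    (List.ofFn fun i => (⟨α i, β i, h i⟩ : UniversalBruhat.Idx)).reverse with ⟨ζ, -, h2⟩ | h0
  · rw [h2] at hx
    exact absurd (Finsupp.single_eq_zero.1 hx) one_ne_zero
  · exact h0
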